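/- Let $R$ be an integral domain and let $n\ge 1$ be an integer. For each $k\in\{1,\dots,n\}$ let $E_k\subseteq S_k\subseteq R$ be finite sets and let $\psi_k$ be a function assigning a positive integer $\psi_k(u)$ to every $u\in S_k$. For $r\in\mathbb N=\{0,1,2,\dots\}$, call $H\subseteq R^n$ an $r$-hyperplane of $R^n$ if there is a nonzero polynomial $h\in R[x_1,\dots,x_n]$ of total degree $r$ with $H=\{u\in R^n\mid h(u_1,\dots,u_n)=0\}$; a $1$-hyperplane is called a hyperplane. Let $L$ be a finite set, let $(H_\lambda)_{\lambda\in L}$ be a family of subsets of $R^n$ with $\prod_{i=1}^n S_i\not\subseteq\bigcup_{\lambda\in L}H_\lambda$, and let $t\ge 1$ be an integer. Assume that for every $a\in\bigl(\prod_{i=1}^n S_i\bigr)\setminus\bigl(\prod_{i=1}^n E_i\bigr)$, $$|\{\lambda\in L\mid a\in H_\lambda\}|\ \ge\ \max\Bigl\{\sum_{i=1}^n\beta_i\ \Bigm|\ \beta\in\mathbb N^n,\ \sum_{i=1}^n\Bigl\lfloor\frac{\beta_i}{\psi_i(a_i)}\Bigr\rfloor\le t-1\Bigr\}+1 .$$ Then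 the following two statements hold. (1) If $(e_\lambda)_{\lambda\in L}\in\mathbb N^L$ and $H_\lambda$ is an $e_\lambda$-hyperplane of $R^n$ for every $\lambda\in L$, then for every $m\in\{1,\dots,n\}$, $$\sum_{\lambda\in L}e_\lambda\ \ge\ (t-1)\sum_{u\in S_m\setminus E_m}\psi_m(u)+\sum_{k=1}^n\ \sum_{u\in S_k\setminus E_k}\psi_k(u).$$ (2) If $H_\lambda$ is a hyperplane of $R^n$ for every $\lambda\in L$, then for every $m\in\{1,\dots,n\}$, $$|L|\ \ge\ (t-1)\sum_{u\in S_m\setminus E_m}\psi_m(u)+\sum_{k=1}^n\ \sum_{u\in S_k\setminus E_k}\psi_k(u).$$ -/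

import Mathlib

namespace HyperplaneCover

/-- `H ⊆ Rⁿ` is an `r`-hyperplane: the zero set of a polynomial of (total) degree exactly `r`.
The zero polynomial has no degree in `ℕ`, so the defining polynomial is nonzero. -/
def IsHyperplaneOfDegree {R : Type*} [CommRing R] {n : ℕ} (r : ℕ) (H : Set (Fin n → R)) : Prop :=
  ∃ h : MvPolynomial (Fin n) R, h ≠ 0 ∧ h.totalDegree = r ∧ H = {u | MvPolynomial.eval u h = 0}

/-- A hyperplane of `Rⁿ` is a `1`-hyperplane. -/
def IsHyperplane {R : Type*} [CommRing R] {n : ℕ} (H : Set (Fin n → R)) : Prop :=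
  IsHyperplaneOfDegree 1 H

/-- The set `{∑ i, β i | β ∈ ℕⁿ, ∑ i, ⌊β i / c i⌋ ≤ t - 1}`, for a positive integer `t`
(natural number division rounds down). -/
def orderSums {n : ℕ} (c : Fin n → ℕ) (t : ℕ) : Set ℕ :=
  {s | ∃ β : Fin n → ℕ, ∑ i, β i / c i ≤ t - 1 ∧ s = ∑ i, β i}

/-- The maximum of `orderSums c t`; see `isGreatest_maxOrderSum`. -/
noncomputable def maxOrderSum {n : ℕ} (c : Fin n → ℕ) (t : ℕ) : ℕ :=
  sSup (orderSums c t)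

/-- For positive `c i` the set is nonempty and bounded, so that the supremum is a maximum. -/
theorem isGreatest_maxOrderSum {n : ℕ} (c : Fin n → ℕ) (hc : ∀ i, 0 < c i) (t : ℕ) :
    IsGreatest (orderSums c t) (maxOrderSum c t) := by
  have hne : (orderSums c t).Nonempty := ⟨0, fun _ => 0, by simp, by simp⟩
  have hb : BddAbove (orderSums c t) := by
    refine ⟨∑ i, c i * (t - 1 + 1), ?_⟩
    rintro s ⟨β, hβ, rfl⟩
    refine Finset.sum_le_sum fun i _ => ?_
    have h1 : β i / c i ≤ t - 1 :=
      (Finset.single_le_sum (f := fun i => β i / c i) (fun _ _ => Nat.zero_le _)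
        (Finset.mem_univ i)).trans hβ
    exact (Nat.lt_mul_of_div_lt (Nat.lt_succ_of_le h1) (hc i)).le.trans (by rw [Nat.mul_comm])
  exact ⟨Nat.sSup_mem hne hb, fun s hs => le_csSup hb hs⟩

end HyperplaneCover

/-! Fix an uncovered point `b`; it lies in `∏ E k`. Keep only the grid with sides `{b k} ∪ (S k \ E
k)`, so that `b` is its only point in `∏ E k`. Give `u ≠ b k` multiplicity `ψ k u`, times `t` in
direction `m`, and give `b k` multiplicity 1. At any other point `a` of the grid more than `∑ (μ k
(a k) - 1)` of the polynomials vanish, so by pigeonhole their product `P` lies in the ideal of the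
`(X k - a k) ^ μ k (a k)`, while `P(b) ≠ 0`.

The degree bound (`le_totalDegree_of_mem_span_X_sub_C_pow`) is dual: with `g k = ∏ (X - u) ^ μ k u`,
let `Λ` be the tensor product of the functionals "top coefficient of the remainder mod `g k`". It
kills every polynomial of degree below `∑ (deg g k - 1)`, the claimed bound. A Chinese remainder
partition of unity localizes `Λ P` at `b`, where it is a nonzero multiple of `P(b)`. -/

namespace HyperplaneCover

/-! ### Pigeonhole for powers of ideals. -/

section PowerIdeal

variable {A ι : Type*} [CommRing A] [Fintype ι] [DecidableEq ι]

/-- The tight pigeonhole bound for powers of a finitely generated ideal. -/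
theorem span_range_pow_le_span_range_pow (y : ι → A) (N : ℕ) (m : ι → ℕ)
    (h : ∑ k, (m k - 1) < N) :
    Ideal.span (Set.range y) ^ N ≤ Ideal.span (Set.range fun k => y k ^ m k) := by
  induction N generalizing m with
  | zero => omega
  | succ N ih =>
    rw [pow_succ', Ideal.mul_le]
    intro f hf g hg
    induction hf using Submodule.span_induction with
    | zero => simp
    | add f₁ f₂ _ _ h₁ h₂ => rw [add_mul]; exact add_mem h₁ h₂
    | smul c f₁ _ h₁ => rw [smul_eq_mul, mul_assoc]; exact Ideal.mul_mem_left _ _ h₁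
    | mem f hf =>
      obtain ⟨k, rfl⟩ := hf
      have hk : y k ^ m k ∈ Ideal.span (Set.range fun k => y k ^ m k) :=
        Ideal.subset_span ⟨k, rfl⟩
      -- For `m k ≤ 1` the factor `y k` is already in the ideal; otherwise it pays for lowering `m
      -- k` by one in the induction.
      by_cases hm : m k ≤ 1
      · refine Ideal.mul_mem_right _ _ (Ideal.mem_of_dvd _ ?_ hk)
        simpa using pow_dvd_pow (y k) hm
      · have hlt : ∑ j, (Function.update m k (m k - 1) j - 1) < N := by
          refine lt_of_lt_of_le (Finset.sum_lt_sum ?_ ⟨k, Finset.mem_univ _, ?_⟩)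
            (Nat.lt_succ_iff.mp h)
          · intro j _
            by_cases hj : j = k
            · subst hj; simp only [Function.update_self]; omega
            · simp [hj]
          · simp only [Function.update_self]; omega
        have hg' := ih _ hlt hg
        clear hg
        induction hg' using Submodule.span_induction with
        | zero => simp
        | add g₁ g₂ _ _ h₁ h₂ => rw [mul_add]; exact add_mem h₁ h₂
        | smul c g₁ _ h₁ => rw [smul_eq_mul, mul_left_comm]; exact Ideal.mul_mem_left _ _ h₁
        | mem g hg =>
          obtain ⟨j, rfl⟩ := hg
          by_cases hj : j = k
          · subst hj
            simpa [← pow_succ', Nat.sub_add_cancel (by omega : 1 ≤ m j)] using hk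
          · simpa [hj] using Ideal.mul_mem_left _ (y k)
              (Ideal.subset_span ⟨j, rfl⟩ : y j ^ m j ∈ Ideal.span (Set.range fun k => y k ^ m k))

end PowerIdeal

/-! ### From vanishing at a point to ideal membership. -/

section Vanishing

variable {R ι : Type*} [CommRing R]

theorem sub_C_eval_mem_span_X_sub_C (a : ι → R) (h : MvPolynomial ι R) :
    h - MvPolynomial.C (MvPolynomial.eval a h) ∈
      Ideal.span (Set.range fun k => (MvPolynomial.X k - MvPolynomial.C (a k) :
        MvPolynomial ι R)) := by
  induction h using MvPolynomial.induction_on with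
  | C c => simp
  | add p q hp hq =>
    convert add_mem hp hq using 1
    simp only [map_add]; ring
  | mul_X p k hp =>
    have hk : (MvPolynomial.X k - MvPolynomial.C (a k) : MvPolynomial ι R) ∈
      Ideal.span (Set.range fun k => (MvPolynomial.X k - MvPolynomial.C (a k) :
        MvPolynomial ι R)) := Ideal.subset_span ⟨k, rfl⟩
    convert add_mem (Ideal.mul_mem_right (MvPolynomial.X k) _ hp)
      (Ideal.mul_mem_left _ (MvPolynomial.C (MvPolynomial.eval a p)) hk) using 1
    simp only [map_mul, MvPolynomial.eval_X]; ring

/-- A product of polynomials of which more than `∑ (m k - 1)` vanish at `a` lies in the ideal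
generated by the powers `(X k - a k) ^ m k`. -/
theorem prod_mem_span_X_sub_C_pow [Fintype ι] [DecidableEq ι] {L : Type*} [Fintype L]
    (a : ι → R) (m : ι → ℕ) (h : L → MvPolynomial ι R)
    (hcard : ∑ k, (m k - 1) < Set.ncard {l | MvPolynomial.eval a (h l) = 0}) :
    ∏ l, h l ∈ Ideal.span (Set.range fun k =>
      (MvPolynomial.X k - MvPolynomial.C (a k) : MvPolynomial ι R) ^ m k) := by
  classical
  have hs : {l | MvPolynomial.eval a (h l) = 0} =
      ((Finset.univ.filter fun l => MvPolynomial.eval a (h l) = 0 : Finset L) : Set L) := by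
    ext; simp
  rw [hs, Set.ncard_coe_finset] at hcard
  rw [← Finset.prod_filter_mul_prod_filter_not Finset.univ
    (fun l => MvPolynomial.eval a (h l) = 0)]
  refine Ideal.mul_mem_right _ _ (span_range_pow_le_span_range_pow _ _ m hcard ?_)
  rw [← Finset.prod_const]
  refine Ideal.prod_mem_prod fun l hl => ?_
  have := sub_C_eval_mem_span_X_sub_C a (h l)
  rwa [(Finset.mem_filter.mp hl).2, map_zero, sub_zero] at this

end Vanishing

/-! ### Tensor products of univariate functionals. -/

section TensorFunctional

variable {R ι : Type*} [CommRing R] [Fintype ι]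

open Polynomial in
/-- The tensor product of linear functionals on `R[X]`, as a functional on `MvPolynomial ι R`. -/
noncomputable def tensorFunctional (ℓ : ι → R[X] →ₗ[R] R) : MvPolynomial ι R →ₗ[R] R :=
  (MvPolynomial.basisMonomials ι R).constr R fun α => ∏ k, ℓ k (Polynomial.X ^ α k)

open Polynomial

variable (ℓ : ι → R[X] →ₗ[R] R)

theorem tensorFunctional_monomial (α : ι →₀ ℕ) (c : R) :
    tensorFunctional ℓ (MvPolynomial.monomial α c) = c * ∏ k, ℓ k (X ^ α k) := by
  have h := (MvPolynomial.basisMonomials ι R).constr_basis R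
    (fun α : ι →₀ ℕ => ∏ k, ℓ k (X ^ α k)) α
  rw [MvPolynomial.coe_basisMonomials] at h
  rw [← mul_one c, ← smul_eq_mul, ← MvPolynomial.smul_monomial, map_smul, smul_eq_mul,
    tensorFunctional, h]
  simp

theorem tensorFunctional_prod_aeval [DecidableEq ι] (f : ι → R[X]) :
    tensorFunctional ℓ (∏ k, aeval (MvPolynomial.X k) (f k)) = ∏ k, ℓ k (f k) := by
  have h₁ : ∀ k, aeval (MvPolynomial.X k : MvPolynomial ι R) (f k) =
      ∑ j ∈ (f k).support, MvPolynomial.C ((f k).coeff j) * MvPolynomial.X k ^ j := fun k => by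
    simp [aeval_def, eval₂_eq_sum, Polynomial.sum_def, MvPolynomial.algebraMap_eq]
  have h₂ : ∀ k, ℓ k (f k) = ∑ j ∈ (f k).support, (f k).coeff j * ℓ k (X ^ j) := fun k => by
    conv_lhs => rw [(f k).as_sum_support_C_mul_X_pow]
    simp [← smul_eq_C_mul]
  simp only [h₁, h₂, Finset.prod_univ_sum, map_sum]
  refine Finset.sum_congr rfl fun a _ => ?_
  have h₃ : ∏ k, MvPolynomial.C ((f k).coeff (a k)) * MvPolynomial.X k ^ a k =
      MvPolynomial.monomial (Finsupp.equivFunOnFinite.symm a) (∏ k, (f k).coeff (a k)) := by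
    rw [MvPolynomial.monomial_eq, Finset.prod_mul_distrib, map_prod,
      Finsupp.prod_fintype _ _ (by simp)]
    simp
  rw [h₃, tensorFunctional_monomial, Finset.prod_mul_distrib]
  simp

/-- Each monomial of `P` has some exponent `α k < d k`, which makes one factor of its value zero. -/
theorem tensorFunctional_eq_zero_of_totalDegree_lt (d : ι → ℕ)
    (hℓ : ∀ k, ∀ j < d k, ℓ k (X ^ j) = 0) (P : MvPolynomial ι R)
    (hP : P.totalDegree < ∑ k, d k) : tensorFunctional ℓ P = 0 := by
  rw [P.as_sum, map_sum]
  refine Finset.sum_eq_zero fun α hα => ?_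
  rw [tensorFunctional_monomial]
  obtain ⟨k, -, hk⟩ : ∃ k ∈ Finset.univ, α k < d k := by
    refine Finset.exists_lt_of_sum_lt (lt_of_le_of_lt ?_ hP)
    have := MvPolynomial.le_totalDegree hα
    rwa [Finsupp.sum_fintype _ _ (by simp)] at this
  rw [Finset.prod_eq_zero (Finset.mem_univ k) (hℓ k _ hk), mul_zero]

/-- On a monomial times `g(X k)` the functional still factors, with `k`-th factor `ℓ k (X ^ α k *
g)`. -/
theorem tensorFunctional_mul_aeval_eq_zero [DecidableEq ι] (k : ι) (g : R[X])
    (hg : ∀ f, ℓ k (f * g) = 0) (P : MvPolynomial ι R) :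
    tensorFunctional ℓ (P * aeval (MvPolynomial.X k) g) = 0 := by
  induction P using MvPolynomial.induction_on' with
  | add p q hp hq => rw [add_mul, map_add, hp, hq, add_zero]
  | monomial α c =>
    have h : MvPolynomial.monomial α c * aeval (MvPolynomial.X k) g =
        c • ∏ j, aeval (MvPolynomial.X j : MvPolynomial ι R)
          (X ^ α j * if j = k then g else 1) := by
      simp only [map_mul, map_pow, aeval_X]
      rw [Finset.prod_mul_distrib, Finset.prod_eq_single_of_mem
        (f := fun j => aeval (MvPolynomial.X j) (if j = k then g else 1)) k (Finset.mem_univ k)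
        (fun j _ hj => by simp [hj]), if_pos rfl, MvPolynomial.monomial_eq,
        Finsupp.prod_fintype _ _ (by simp), MvPolynomial.smul_eq_C_mul, mul_assoc]
    rw [h, map_smul, tensorFunctional_prod_aeval, Finset.prod_eq_zero (Finset.mem_univ k),
      smul_zero]
    simpa using hg _

end TensorFunctional

/-! ### Remainders and idempotents in one variable. -/

section Hermite

open Polynomial

variable {K : Type*} [Field K]

/-- The top coefficient of the Hermite interpolant: the coefficient of `X ^ (deg g - 1)` in the
remainder modulo `g`. -/
noncomputable def topRemainderCoeff (g : K[X]) : K[X] →ₗ[K] K :=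
  lcoeff K (g.natDegree - 1) ∘ₗ modByMonicHom g

theorem topRemainderCoeff_mul_self {g : K[X]} (hg : g.Monic) (f : K[X]) :
    topRemainderCoeff g (f * g) = 0 := by
  simp [topRemainderCoeff, modByMonicHom, (modByMonic_eq_zero_iff_dvd hg).mpr (dvd_mul_left g f)]

theorem topRemainderCoeff_of_natDegree_lt {g f : K[X]} (hg : g.Monic)
    (h : f.natDegree < g.natDegree) :
    topRemainderCoeff g f = f.coeff (g.natDegree - 1) := by
  have : f %ₘ g = f := (modByMonic_eq_self_iff hg).mpr (degree_lt_degree h)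
  simp [topRemainderCoeff, modByMonicHom, this]

variable {α : Type*} [DecidableEq α]

/-- A partition of unity for the Chinese remainder theorem modulo `g = ∏ (X - v u) ^ m u`, at a
simple root `v b`; the last clause says that the idempotent at `v b` is seen by
`topRemainderCoeff g`. -/
theorem exists_partition_of_unity {v : α → K} (hv : Function.Injective v) (S : Finset α)
    (m : α → ℕ) {b : α} (hb : b ∈ S) (hmb : m b = 1) :
    ∃ e : α → K[X], ∑ u ∈ S, e u = 1 ∧
      (∀ u ∈ S, ∏ w ∈ S, (X - C (v w)) ^ m w ∣ (X - C (v u)) ^ m u * e u) ∧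
      topRemainderCoeff (∏ w ∈ S, (X - C (v w)) ^ m w) (e b) ≠ 0 := by
  set p : α → K[X] := fun w => (X - C (v w)) ^ m w with hp
  have hcop : Pairwise (Function.onFun IsCoprime fun u : S => p u) := fun u w huw =>
    (pairwise_coprime_X_sub_C hv (fun h => huw (Subtype.ext h))).pow
  obtain ⟨c, hc⟩ := (exists_sum_eq_one_iff_pairwise_coprime ⟨b, hb⟩).mpr hcop
  have hsplit : ∀ u ∈ S, p u * ∏ w ∈ S \ {u}, p w = ∏ w ∈ S, p w := fun u hu => by
    rw [Finset.sdiff_singleton_eq_erase, Finset.mul_prod_erase _ _ hu]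
  refine ⟨_, hc, fun u hu => ⟨c u, ?_⟩, ?_⟩
  · rw [← hsplit u hu]; ring
  have hmonic : ∀ T : Finset α, (∏ w ∈ T, p w).Monic := fun T =>
    monic_prod_of_monic _ _ fun w _ => (monic_X_sub_C _).pow _
  set q := ∏ w ∈ S \ {b}, p w with hq
  have hg : (X - C (v b)) * q = ∏ w ∈ S, p w := by
    rw [← hsplit b hb, hp]; simp [hmb, hq, hp]
  have hdeg : (∏ w ∈ S, p w).natDegree = q.natDegree + 1 := by
    rw [← hg, (monic_X_sub_C _).natDegree_mul (hmonic _), natDegree_X_sub_C, add_comm]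
  -- Evaluate the partition of unity at `v b`: every summand with `u ≠ b` contains the factor `X - v
  -- b`.
  have hcb : (c b).eval (v b) ≠ 0 := by
    intro h0
    have := congrArg (eval (v b)) hc
    rw [eval_finsetSum, eval_one, Finset.sum_eq_zero] at this
    · exact zero_ne_one this
    intro u hu
    by_cases hub : u = b
    · simp [hub, h0]
    · rw [eval_mul, eval_prod, Finset.prod_eq_zero (i := b), mul_zero]
      · simpa using ⟨hb, fun h => hub h.symm⟩
      · simp [hp, hmb]
  obtain ⟨r, hr⟩ : X - C (v b) ∣ c b - C ((c b).eval (v b)) := X_sub_C_dvd_sub_C_eval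
  -- Since `(X - v b) * q` is the modulus, `c b` acts on `q` as its value at `v b`; and `q` is monic
  -- of degree one less than the modulus.
  have he : c b * q = (c b).eval (v b) • q + r * ∏ w ∈ S, p w := by
    rw [← hg, smul_eq_C_mul]; linear_combination q * hr
  rw [he, map_add, topRemainderCoeff_mul_self (hmonic S), map_smul,
    topRemainderCoeff_of_natDegree_lt (hmonic S) (by omega), hdeg, Nat.add_sub_cancel, add_zero,
    (hmonic _).coeff_natDegree]
  simpa using hcb

end Hermite

/-! ### Degree bound on a grid with multiplicities. -/

section Core

open Polynomial

variable {K ι α : Type*} [Field K] [Fintype ι] [DecidableEq ι] [DecidableEq α]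

/-- A polynomial not vanishing at one point `b` of a grid, and lying in the ideals
`((X k - a k) ^ m k (a k))` at all other points `a`, where `m k (b k) = 1`, has degree at least
the number of the points different from `b k` in the factors of the grid, counted with their
multiplicities `m k`. -/
theorem le_totalDegree_of_mem_span_X_sub_C_pow {v : α → K} (hv : Function.Injective v)
    (S : ι → Finset α) (m : ι → α → ℕ) (b : ι → α) (hb : ∀ k, b k ∈ S k)
    (hmb : ∀ k, m k (b k) = 1) (P : MvPolynomial ι K)
    (hPb : MvPolynomial.eval (fun k => v (b k)) P ≠ 0)
    (hP : ∀ a ∈ Fintype.piFinset S, a ≠ b → P ∈ Ideal.span (Set.range fun k =>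
      (MvPolynomial.X k - MvPolynomial.C (v (a k)) : MvPolynomial ι K) ^ m k (a k))) :
    ∑ k, ∑ u ∈ (S k).erase (b k), m k u ≤ P.totalDegree := by
  choose e hsum hdvd hne using fun k => exists_partition_of_unity hv (S k) (m k) (hb k) (hmb k)
  set g : ι → K[X] := fun k => ∏ w ∈ S k, (X - C (v w)) ^ m k w with hg
  have hmonic : ∀ k, (g k).Monic := fun k =>
    monic_prod_of_monic _ _ fun w _ => (monic_X_sub_C _).pow _
  have hdeg : ∀ k, (g k).natDegree = ∑ u ∈ (S k).erase (b k), m k u + 1 := fun k => by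
    rw [hg, natDegree_prod_of_monic _ _ fun w _ => (monic_X_sub_C _).pow _,
      ← Finset.sum_erase_add _ _ (hb k)]
    simp [(monic_X_sub_C _).natDegree_pow, hmb]
  set Λ := tensorFunctional fun k => topRemainderCoeff (g k) with hΛ
  set ε : (ι → α) → MvPolynomial ι K := fun a =>
    ∏ k, aeval (MvPolynomial.X k) (e k (a k)) with hε
  have hone : ∑ a ∈ Fintype.piFinset S, ε a = 1 := by
    simp only [hε]
    rw [← Finset.prod_univ_sum S fun k u => aeval (MvPolynomial.X k : MvPolynomial ι K) (e k u)]
    simp [← map_sum, hsum]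
  have hkill : ∀ a ∈ Fintype.piFinset S, ∀ Q ∈ Ideal.span (Set.range fun k =>
      (MvPolynomial.X k - MvPolynomial.C (v (a k)) : MvPolynomial ι K) ^ m k (a k)),
      Λ (Q * ε a) = 0 := by
    intro a ha Q hQ
    obtain ⟨c, rfl⟩ := Ideal.mem_span_range_iff_exists_fun.mp hQ
    rw [Finset.sum_mul, map_sum]
    refine Finset.sum_eq_zero fun k _ => ?_
    obtain ⟨r, hr⟩ := hdvd k (a k) (Fintype.mem_piFinset.mp ha k)
    have hr' := congrArg (aeval (MvPolynomial.X k : MvPolynomial ι K)) hr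
    simp only [map_mul, map_pow, map_sub, aeval_X, aeval_C, MvPolynomial.algebraMap_eq] at hr'
    have : c k * (MvPolynomial.X k - MvPolynomial.C (v (a k))) ^ m k (a k) * ε a =
        (c k * aeval (MvPolynomial.X k) r * ∏ j ∈ Finset.univ.erase k,
          aeval (MvPolynomial.X j) (e j (a j))) * aeval (MvPolynomial.X k) (g k) := by
      rw [hε]
      simp only
      rw [← Finset.mul_prod_erase _ _ (Finset.mem_univ k)]
      linear_combination c k * (∏ j ∈ Finset.univ.erase k,
          aeval (MvPolynomial.X j) (e j (a j))) * hr'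
    rw [this]
    exact tensorFunctional_mul_aeval_eq_zero _ k _ (topRemainderCoeff_mul_self (hmonic k)) _
  have hb' : b ∈ Fintype.piFinset S := Fintype.mem_piFinset.mpr hb
  have hΛP : Λ P = MvPolynomial.eval (fun k => v (b k)) P *
      ∏ k, topRemainderCoeff (g k) (e k (b k)) := by
    have hsplit : Λ P = ∑ a ∈ Fintype.piFinset S, Λ (P * ε a) := by
      rw [← map_sum, ← Finset.mul_sum, hone, mul_one]
    rw [hsplit, Finset.sum_eq_single_of_mem b hb' fun a ha hab => hkill a ha P (hP a ha hab)]
    -- All exponents at `b` are 1, so the ideal there contains `P - P(b)` and only the constant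
    -- `P(b)` survives.
    have h := hkill b hb' (P - MvPolynomial.C (MvPolynomial.eval (fun k => v (b k)) P)) (by
      simpa [hmb] using sub_C_eval_mem_span_X_sub_C (fun k => v (b k)) P)
    rw [sub_mul, map_sub, sub_eq_zero, ← MvPolynomial.smul_eq_C_mul, map_smul, smul_eq_mul] at h
    rw [h, hΛ, hε, tensorFunctional_prod_aeval]
  by_contra! hlt
  refine mul_ne_zero hPb (Finset.prod_ne_zero_iff.mpr fun k _ => hne k) (hΛP.symm.trans ?_)
  refine tensorFunctional_eq_zero_of_totalDegree_lt _ _ (fun k j hj => ?_) P hlt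
  rw [topRemainderCoeff_of_natDegree_lt (hmonic k) (by rw [natDegree_X_pow, hdeg]; omega), hdeg,
    Nat.add_sub_cancel, coeff_X_pow, if_neg hj.ne']

end Core

/-! ### Application to covers. -/

/-- The bound on the sum of the degrees of a punctured cover of a grid with multiplicities. -/
theorem sum_le_sum_degree_of_cover {R : Type*} [CommRing R] [IsDomain R] [DecidableEq R] {n : ℕ}
    (S E : Fin n → Finset R) (hES : ∀ k, E k ⊆ S k)
    (ψ : Fin n → R → ℕ) (hψ : ∀ k, ∀ u ∈ S k, 0 < ψ k u)
    {L : Type*} [Fintype L] (H : L → Set (Fin n → R))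
    (hmiss : ¬ (Set.univ.pi (fun k => (S k : Set R)) ⊆ ⋃ l, H l))
    (t : ℕ) (ht : 0 < t)
    (hcover : ∀ a ∈ Set.univ.pi (fun k => (S k : Set R)) \ Set.univ.pi (fun k => (E k : Set R)),
      maxOrderSum (fun i => ψ i (a i)) t + 1 ≤ Set.ncard {l : L | a ∈ H l})
    (e : L → ℕ) (he : ∀ l, IsHyperplaneOfDegree (e l) (H l)) (m : Fin n) :
    (t - 1) * (∑ u ∈ S m \ E m, ψ m u) + ∑ k, ∑ u ∈ S k \ E k, ψ k u ≤ ∑ l, e l := by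
  obtain ⟨b, hbS, hbH⟩ := Set.not_subset.mp hmiss
  have hbE : ∀ k, b k ∈ E k := by
    -- Outside `∏ E k` the `+ 1` in the hypothesis forces at least one covering set.
    by_contra hb
    have h := hcover b ⟨hbS, fun h => hb fun k => h k trivial⟩
    have h0 : {l : L | b ∈ H l} = ∅ := by
      ext l; simpa using fun hl => hbH (Set.mem_iUnion.mpr ⟨l, hl⟩)
    rw [h0, Set.ncard_empty] at h
    omega
  choose h _ hdeg hH using he
  -- Over a field, `X - u` and `X - w` are coprime for `u ≠ w`, as the Chinese remainder argument
  -- needs.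
  let v := algebraMap R (FractionRing R)
  have hv : Function.Injective v := IsFractionRing.injective R (FractionRing R)
  let μ : Fin n → R → ℕ := fun k u =>
    if u = b k then 1 else if k = m then t * ψ k u else ψ k u
  let T : Fin n → Finset R := fun k => insert (b k) (S k \ E k)
  have hbT : ∀ k, b k ∉ S k \ E k := fun k hk => (Finset.mem_sdiff.mp hk).2 (hbE k)
  have hTS : ∀ k, T k ⊆ S k := fun k => Finset.insert_subset (hES k (hbE k)) Finset.sdiff_subset
  let P : MvPolynomial (Fin n) (FractionRing R) := ∏ l, MvPolynomial.map v (h l)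
  have heval : ∀ (a : Fin n → R) l, MvPolynomial.eval (fun k => v (a k))
      (MvPolynomial.map v (h l)) = 0 ↔ a ∈ H l := fun a l => by
    have : MvPolynomial.eval (fun k => v (a k)) (MvPolynomial.map v (h l)) =
        v (MvPolynomial.eval a (h l)) := by
      rw [MvPolynomial.eval_map, MvPolynomial.eval, MvPolynomial.coe_eval₂Hom,
        MvPolynomial.hom_eval₂]
      rfl
    rw [this, hH l, map_eq_zero_iff _ hv]
    rfl
  have key := le_totalDegree_of_mem_span_X_sub_C_pow hv T μ b
    (fun k => Finset.mem_insert_self _ _) (fun k => if_pos rfl) P ?_ ?_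
  · calc (t - 1) * (∑ u ∈ S m \ E m, ψ m u) + ∑ k, ∑ u ∈ S k \ E k, ψ k u
        = ∑ k, ∑ u ∈ (T k).erase (b k), μ k u := by
          have h₁ : ∀ k, ∑ u ∈ (T k).erase (b k), μ k u =
              (if k = m then (t - 1) * ∑ u ∈ S k \ E k, ψ k u else 0) +
                ∑ u ∈ S k \ E k, ψ k u := fun k => by
            rw [Finset.erase_insert (hbT k), Finset.sum_congr rfl fun u hu =>
              if_neg (ne_of_mem_of_not_mem hu (hbT k))]
            by_cases hk : k = m
            · simp only [if_pos hk, ← Finset.mul_sum]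
              rw [← Nat.succ_mul, Nat.succ_eq_add_one, Nat.sub_add_cancel ht]
            · simp only [if_neg hk, zero_add]
          simp only [h₁, Finset.sum_add_distrib, Finset.sum_ite_eq', Finset.mem_univ, if_true]
      _ ≤ P.totalDegree := key
      _ ≤ ∑ l, (MvPolynomial.map v (h l)).totalDegree := MvPolynomial.totalDegree_finsetProd _ _
      _ ≤ ∑ l, e l := Finset.sum_le_sum fun l _ =>
          (Finset.sup_mono (MvPolynomial.support_map_subset _ _)).trans (hdeg l).le
  · rw [map_prod]
    exact Finset.prod_ne_zero_iff.mpr fun l _ h0 =>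
      hbH (Set.mem_iUnion.mpr ⟨l, (heval b l).mp h0⟩)
  · intro a ha hab
    have haT := Fintype.mem_piFinset.mp ha
    have hpos : ∀ k, 0 < ψ k (a k) := fun k => hψ k _ (hTS k (haT k))
    refine prod_mem_span_X_sub_C_pow (fun k => v (a k)) _ _ ?_
    simp only [heval]
    refine lt_of_lt_of_le (Nat.lt_succ_of_le ?_) (hcover a ⟨fun k _ => hTS k (haT k), ?_⟩)
    -- Take `β = μ - 1`: its quotient by `ψ` is at most `(t * ψ - 1) / ψ = t - 1` in direction `m`
    -- and `(ψ - 1) / ψ = 0` elsewhere.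
    · refine (isGreatest_maxOrderSum _ hpos t).2 ⟨fun k => μ k (a k) - 1, ?_, rfl⟩
      calc ∑ k, (μ k (a k) - 1) / ψ k (a k) ≤ ∑ k, if k = m then t - 1 else 0 := by
            refine Finset.sum_le_sum fun k _ => Nat.lt_succ_iff.mp ?_
            rw [Nat.div_lt_iff_lt_mul (hpos k)]
            have := hpos k
            by_cases hk : k = m
            · have : 0 < t * ψ k (a k) := Nat.mul_pos ht (hpos k)
              simp only [μ, if_pos hk, Nat.succ_eq_add_one, Nat.sub_add_cancel ht]
              split_ifs <;> omega
            · simp only [μ, if_neg hk]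
              split_ifs <;> omega
        _ = t - 1 := by simp
    · intro haE
      refine hab (funext fun k => ?_)
      rcases Finset.mem_insert.mp (haT k) with hk | hk
      · exact hk
      · exact absurd (haE k trivial) (Finset.mem_sdiff.mp hk).2

end HyperplaneCover

theorem corollary6p1 {R : Type*} [CommRing R] [IsDomain R] [DecidableEq R] {n : ℕ}
    (S E : Fin n → Finset R) (hES : ∀ k, E k ⊆ S k)
    (ψ : Fin n → R → ℕ) (hψ : ∀ k, ∀ u ∈ S k, 0 < ψ k u)
    {L : Type*} [Fintype L] (H : L → Set (Fin n → R))
    (hmiss : ¬ (Set.univ.pi (fun k => (S k : Set R)) ⊆ ⋃ l, H l))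
    (t : ℕ) (ht : 0 < t)
    (hcover : ∀ a ∈ Set.univ.pi (fun k => (S k : Set R)) \ Set.univ.pi (fun k => (E k : Set R)),
      HyperplaneCover.maxOrderSum (fun i => ψ i (a i)) t + 1 ≤ Set.ncard {l : L | a ∈ H l}) :
    (∀ e : L → ℕ, (∀ l, HyperplaneCover.IsHyperplaneOfDegree (e l) (H l)) →
      ∀ m : Fin n,
        (t - 1) * (∑ u ∈ S m \ E m, ψ m u) + ∑ k, ∑ u ∈ S k \ E k, ψ k u ≤ ∑ l, e l) ∧
    ((∀ l, HyperplaneCover.IsHyperplane (H l)) →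
      ∀ m : Fin n,
        (t - 1) * (∑ u ∈ S m \ E m, ψ m u) + ∑ k, ∑ u ∈ S k \ E k, ψ k u
          ≤ Fintype.card L) := by
  have key := HyperplaneCover.sum_le_sum_degree_of_cover S E hES ψ hψ H hmiss t ht hcover
  exact ⟨key, fun h m => by simpa using key (fun _ => 1) h m⟩
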